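/- Let $n\ge 1$ be an integer, let $T\in(0,\infty]$, write $S^1=\mathbb R/2\pi\mathbb Z$ and $\mathbb C^*=\mathbb C\setminus\{0\}$, and let $\langle\cdot,\cdot\rangle$ be the real inner product on $\mathbb C=\mathbb R^2$. For a smooth regular closed curve $\gamma:S^1\to\mathbb C^*$ let $\nu=-i\,\gamma'/|\gamma'|$ be its unit normal (outward for a positively oriented simple curve), $k=-\langle\gamma'',\nu\rangle/|\gamma'|^2$ its curvature, and $$f=k+(n-1)\frac{\langle \gamma,\nu\rangle}{|\gamma|^2}.$$ Let $A(\gamma)=\int_{S^1}\gamma^*\lambda$, with $\lambda=\tfrac12(x\,dy-y\,dx)$, be its symplectic area, $\mathrm{wind}_0(\gamma)$ its winding number around the origin, and $\mathrm{rot}(\gamma)$ its rotation number, i.e. the winding number of $\gamma'$ around the origin. Suppose that $z:S^1\times[0,T)\to\mathbb C^*$ is smooth, that each $z_t:=z(\cdot,t)$ is a regular curve ($z_t'\neq 0$ everywhere), and that $z$ solves $$\frac{d}{dt}z=-f\nu,$$ where $f$ and $\nu$ at time $t$ are those of the curve $z_t$. Then for every $t\in[0,T)$ $$A(z_t)=A(z_0)-2\pi\bigl(\mathrm{rot}(z_0)+(n-1)\,\mathrm{wind}_0(z_0)\bigr)\,t.$$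 -/

import Mathlib

open scoped ContDiff

noncomputable section

namespace EquivariantFlow

/-- A continuous choice of polar angle along a curve `γ : ℝ → ℂ`. -/
def IsAngle (γ : ℝ → ℂ) (θ : ℝ → ℝ) : Prop :=
  Continuous θ ∧ ∀ φ, γ φ = (‖γ φ‖ : ℂ) * Complex.exp (θ φ * Complex.I)

open Classical in
/-- The winding number around the origin of a closed curve in `ℂ \ {0}`, given as a `2π`-periodic
map `γ : ℝ → ℂ`: the number of full turns that a continuous polar angle makes over one period.
(Well defined for continuous nowhere vanishing closed curves, see
`existsUnique_turns` and `windingNumber_spec`; `0` by convention if there is no angle.) -/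
def windingNumber (γ : ℝ → ℂ) : ℤ :=
  if h : ∃ w : ℤ, ∃ θ, IsAngle γ θ ∧ θ (2 * Real.pi) - θ 0 = 2 * Real.pi * w then h.choose else 0

/-- The rotation number (turning number) of a closed regular curve: the number of full turns of
its tangent vector. -/
def rotationNumber (γ : ℝ → ℂ) : ℤ :=
  windingNumber (deriv γ)

/-- The Liouville form `λ = (x dy - y dx) / 2` on `ℂ`, with `λ_p(v) = ⟨J p, v⟩ / 2`. -/
def liouvilleForm (p v : ℂ) : ℝ :=
  (1 / 2) * inner ℝ (Complex.I * p) v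

/-- The symplectic area `∫_{S¹} γ^* λ` of a closed curve. -/
def symplecticArea (γ : ℝ → ℂ) : ℝ :=
  ∫ φ in (0 : ℝ)..(2 * Real.pi), liouvilleForm (γ φ) (deriv γ φ)

/-- The (outward) unit normal `ν = -J (γ' / |γ'|)`. -/
def unitNormal (γ : ℝ → ℂ) (φ : ℝ) : ℂ :=
  -(Complex.I * (deriv γ φ / (‖deriv γ φ‖ : ℂ)))

/-- The curvature `k = -⟨γ'', ν⟩ / |γ'|²`. -/
def curvature (γ : ℝ → ℂ) (φ : ℝ) : ℝ :=
  -(inner ℝ (deriv (deriv γ) φ) (unitNormal γ φ)) / ‖deriv γ φ‖ ^ 2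

/-- The speed `f = k + (n - 1) ⟨γ, ν⟩ / |γ|²`. -/
def speed (n : ℕ) (γ : ℝ → ℂ) (φ : ℝ) : ℝ :=
  curvature γ φ + ((n : ℝ) - 1) * (inner ℝ (γ φ) (unitNormal γ φ) / ‖γ φ‖ ^ 2)

/-- The time interval `[0, T)`, where `T` may be `∞`. -/
def timeInterval (T : EReal) : Set ℝ :=
  {t | 0 ≤ t ∧ (t : EReal) < T}

/-- A smooth solution `z : S¹ × [0, T) → ℂ \ {0}` of the flow `dz/dt = -f ν` of closed regular
curves. Maps on `S¹ = ℝ / 2πℤ` are written as `2π`-periodic maps on `ℝ`; only the values `z φ t`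
with `t ∈ [0, T)` matter, and at `t = 0` the time derivative is the right derivative. -/
structure IsSmoothSolution (n : ℕ) (T : EReal) (z : ℝ → ℝ → ℂ) : Prop where
  periodic : ∀ t ∈ timeInterval T, ∀ φ, z (φ + 2 * Real.pi) t = z φ t
  smooth : ContDiffOn ℝ ∞ (fun p : ℝ × ℝ => z p.1 p.2) (Set.univ ×ˢ timeInterval T)
  ne_zero : ∀ t ∈ timeInterval T, ∀ φ, z φ t ≠ 0
  regular : ∀ t ∈ timeInterval T, ∀ φ, deriv (fun ψ => z ψ t) φ ≠ 0
  flow : ∀ t ∈ timeInterval T, ∀ φ,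
    HasDerivWithinAt (fun s => z φ s)
      (-((speed n (fun ψ => z ψ t) φ : ℂ) * unitNormal (fun ψ => z ψ t) φ)) (timeInterval T) t

theorem exists_isAngle {γ : ℝ → ℂ} (hγ : Continuous γ) (h0 : ∀ φ, γ φ ≠ 0) :
    ∃ θ, IsAngle γ θ := by
  obtain ⟨g, ⟨-, hg⟩, -⟩ := Complex.isCoveringMapOn_exp.existsUnique_continuousMap_lifts
    (⟨γ, hγ⟩ : C(ℝ, ℂ)) (Complex.exp_log (h0 0)) h0
  have hg' : ∀ φ, Complex.exp (g φ) = γ φ := fun φ => congrFun hg φ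
  refine ⟨fun φ => (g φ).im, Complex.continuous_im.comp g.continuous, fun φ => ?_⟩
  rw [← hg' φ, Complex.norm_exp, Complex.ofReal_exp, ← Complex.exp_add, Complex.re_add_im]

theorem exp_angle_eq {γ : ℝ → ℂ} (h0 : ∀ φ, γ φ ≠ 0) {θ : ℝ → ℝ} (h : IsAngle γ θ) (φ : ℝ) :
    Complex.exp (θ φ * Complex.I) = γ φ / (‖γ φ‖ : ℂ) := by
  have : (‖γ φ‖ : ℂ) ≠ 0 := by simpa using h0 φ
  rw [eq_div_iff this, mul_comm]
  exact (h.2 φ).symm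

/-- Every continuous closed curve in `ℂ \ {0}` has exactly one number of turns. -/
theorem existsUnique_turns {γ : ℝ → ℂ} (hγ : Continuous γ) (h0 : ∀ φ, γ φ ≠ 0)
    (hp : γ (2 * Real.pi) = γ 0) :
    ∃! w : ℤ, ∃ θ, IsAngle γ θ ∧ θ (2 * Real.pi) - θ 0 = 2 * Real.pi * w := by
  obtain ⟨θ, hθ⟩ := exists_isAngle hγ h0
  have h1 : Complex.exp (θ (2 * Real.pi) * Complex.I) = Complex.exp (θ 0 * Complex.I) := by
    rw [exp_angle_eq h0 hθ, exp_angle_eq h0 hθ, hp]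
  obtain ⟨w, hw⟩ := Complex.exp_eq_exp_iff_exists_int.1 h1
  have hw' : θ (2 * Real.pi) - θ 0 = 2 * Real.pi * w := by
    have := congrArg Complex.im hw
    simp at this
    linarith
  refine ⟨w, ⟨θ, hθ, hw'⟩, ?_⟩
  rintro w' ⟨θ', hθ', hw''⟩
  have h2 : ∀ φ, Circle.exp (θ' φ) = Circle.exp (θ φ) := fun φ => by
    ext
    rw [Circle.coe_exp, Circle.coe_exp, exp_angle_eq h0 hθ, exp_angle_eq h0 hθ']
  obtain ⟨m, hm⟩ := Circle.exp_eq_exp.1 (h2 0)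
  have h3 : θ' = fun φ => θ φ + m * (2 * Real.pi) := by
    refine Circle.isCoveringMap_exp.eq_of_comp_eq hθ'.1 (hθ.1.add continuous_const) ?_ 0 hm
    funext φ
    exact (h2 φ).trans (Circle.exp_eq_exp.2 ⟨-m, by push_cast; ring⟩)
  have h4 : 2 * Real.pi * (w' : ℝ) = 2 * Real.pi * w := by
    rw [← hw'', ← hw', h3]
    ring
  exact_mod_cast mul_left_cancel₀ Real.two_pi_pos.ne' h4

theorem windingNumber_spec {γ : ℝ → ℂ} (hγ : Continuous γ) (h0 : ∀ φ, γ φ ≠ 0)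
    (hp : γ (2 * Real.pi) = γ 0) {θ : ℝ → ℝ} (hθ : IsAngle γ θ) :
    θ (2 * Real.pi) - θ 0 = 2 * Real.pi * windingNumber γ := by
  have hu := existsUnique_turns hγ h0 hp
  have h1 : Complex.exp (θ (2 * Real.pi) * Complex.I) = Complex.exp (θ 0 * Complex.I) := by
    rw [exp_angle_eq h0 hθ, exp_angle_eq h0 hθ, hp]
  obtain ⟨w, hw⟩ := Complex.exp_eq_exp_iff_exists_int.1 h1
  have hw' : θ (2 * Real.pi) - θ 0 = 2 * Real.pi * w := by
    have := congrArg Complex.im hw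
    simp at this
    linarith
  have h2 : windingNumber γ = w := by
    rw [windingNumber, dif_pos hu.exists]
    exact hu.unique hu.exists.choose_spec ⟨θ, hθ, hw'⟩
  rw [h2, hw']

end EquivariantFlow

end

/-! Integration by parts gives the first variation `A' = -∫ ⟨iγ', ∂ₜz⟩`. Under the flow `∂ₜz = -fν`,
and `⟨iγ', ν⟩ = -|γ'|`, so `A' = -∫ f |γ'|`. By `speed_mul_norm_deriv`, `f |γ'| = Im(γ''/γ') + (n-1)
Im(γ'/γ)`: the angular velocities of the tangent and of the position vector, whose integrals are `2π
rot` and `2π (n-1) wind` (`integral_speed`). Both numbers are integers depending continuously on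
time, hence constant (`windingNumber_eq_of_family`), so `A` has constant slope. -/

namespace EquivariantFlow

/-! ### Calculus on the strip `ℝ × J`. -/

section Calculus

variable {E : Type*} [NormedAddCommGroup E] [NormedSpace ℝ E]

theorem continuousOn_intervalIntegral_param {J : Set ℝ} {G : ℝ → ℝ → E}
    (hG : ContinuousOn (fun p : ℝ × ℝ => G p.1 p.2) (Set.univ ×ˢ J)) (a b : ℝ) :
    ContinuousOn (fun s => ∫ φ in a..b, G φ s) J := by
  rw [continuousOn_iff_continuous_domRestrict]
  refine intervalIntegral.continuous_parametric_intervalIntegral_of_continuous'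
    (f := fun (s : J) φ => G φ s) ?_ a b
  exact hG.comp_continuous (f := fun q : J × ℝ => (q.2, (q.1 : ℝ))) (by fun_prop)
    fun q => ⟨trivial, q.1.2⟩

theorem contDiff_slice_fst {J : Set ℝ} {z : ℝ → ℝ → E}
    (hz : ContDiffOn ℝ ∞ (fun p : ℝ × ℝ => z p.1 p.2) (Set.univ ×ˢ J)) {s : ℝ} (hs : s ∈ J) :
    ContDiff ℝ ∞ (fun φ => z φ s) :=
  hz.comp_contDiff (f := fun φ : ℝ => (φ, s)) (by fun_prop) fun _ => ⟨trivial, hs⟩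

/-- The direction `(1, 0)` runs along the strip, so the derivative within it is a genuine one. Hence
`J` need not be open, and `[0, t]` is allowed. -/
theorem contDiffOn_deriv_fst {J : Set ℝ} (hJ : UniqueDiffOn ℝ J) {z : ℝ → ℝ → E}
    (hz : ContDiffOn ℝ ∞ (fun p : ℝ × ℝ => z p.1 p.2) (Set.univ ×ˢ J)) :
    ContDiffOn ℝ ∞ (fun p : ℝ × ℝ => deriv (fun ψ => z ψ p.2) p.1) (Set.univ ×ˢ J) := by
  have hU : UniqueDiffOn ℝ ((Set.univ : Set ℝ) ×ˢ J) := uniqueDiffOn_univ.prod hJ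
  refine ((hz.fderivWithin hU (m := ∞) (by simp)).clm_apply
    (contDiffOn_const (c := ((1 : ℝ), (0 : ℝ))))).congr fun p hp => ?_
  have h1 := ((hz.differentiableOn (by simp)) p hp).hasFDerivWithinAt
  have h2 : HasDerivWithinAt (fun ψ : ℝ => (ψ, p.2)) ((1 : ℝ), (0 : ℝ)) Set.univ p.1 :=
    ((hasDerivAt_id p.1).prodMk (hasDerivAt_const p.1 p.2)).hasDerivWithinAt
  have h3 := h1.comp_hasDerivWithinAt (f := fun ψ : ℝ => (ψ, p.2)) p.1 h2
    fun ψ _ => ⟨trivial, hp.2⟩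
  exact (hasDerivWithinAt_univ.1 h3).deriv

theorem isOpen_strip {J : Set ℝ} (hJ : IsOpen J) : IsOpen ((Set.univ : Set ℝ) ×ˢ J) :=
  isOpen_univ.prod hJ

theorem hasDerivAt_slice_fst {J : Set ℝ} (hJ : IsOpen J) {z : ℝ → ℝ → E}
    (hz : DifferentiableOn ℝ (fun p : ℝ × ℝ => z p.1 p.2) (Set.univ ×ˢ J)) (φ : ℝ) {s : ℝ}
    (hs : s ∈ J) :
    HasDerivAt (fun ψ => z ψ s) (fderiv ℝ (fun p : ℝ × ℝ => z p.1 p.2) (φ, s) (1, 0)) φ :=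
  ((hz.differentiableAt ((isOpen_strip hJ).mem_nhds (x := (φ, s))
    ⟨trivial, hs⟩)).hasFDerivAt).comp_hasDerivAt φ
      (f := fun ψ : ℝ => (ψ, s)) ((hasDerivAt_id φ).prodMk (hasDerivAt_const φ s))

theorem hasDerivAt_slice_snd {J : Set ℝ} (hJ : IsOpen J) {z : ℝ → ℝ → E}
    (hz : DifferentiableOn ℝ (fun p : ℝ × ℝ => z p.1 p.2) (Set.univ ×ˢ J)) (φ : ℝ) {s : ℝ}
    (hs : s ∈ J) :
    HasDerivAt (fun r => z φ r) (fderiv ℝ (fun p : ℝ × ℝ => z p.1 p.2) (φ, s) (0, 1)) s :=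
  ((hz.differentiableAt ((isOpen_strip hJ).mem_nhds (x := (φ, s))
    ⟨trivial, hs⟩)).hasFDerivAt).comp_hasDerivAt s
      (f := fun r : ℝ => (φ, r)) ((hasDerivAt_const s φ).prodMk (hasDerivAt_id s))

theorem contDiffOn_deriv_snd {J : Set ℝ} (hJ : IsOpen J) {z : ℝ → ℝ → E}
    (hz : ContDiffOn ℝ ∞ (fun p : ℝ × ℝ => z p.1 p.2) (Set.univ ×ˢ J)) :
    ContDiffOn ℝ ∞ (fun p : ℝ × ℝ => deriv (fun r => z p.1 r) p.2) (Set.univ ×ˢ J) :=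
  ((hz.fderiv_of_isOpen (isOpen_strip hJ) (m := ∞) (by simp)).clm_apply
    (contDiffOn_const (c := ((0 : ℝ), (1 : ℝ))))).congr fun p hp =>
      (hasDerivAt_slice_snd hJ (hz.differentiableOn (by simp)) p.1 hp.2).deriv

/-- Equality of mixed partial derivatives. -/
theorem deriv_deriv_comm {J : Set ℝ} (hJ : IsOpen J) {z : ℝ → ℝ → E}
    (hz : ContDiffOn ℝ ∞ (fun p : ℝ × ℝ => z p.1 p.2) (Set.univ ×ˢ J)) (φ : ℝ) {s : ℝ}
    (hs : s ∈ J) :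
    deriv (fun r => deriv (fun ψ => z ψ r) φ) s = deriv (fun ψ => deriv (fun r => z ψ r) s) φ := by
  set F : ℝ × ℝ → E := fun p => z p.1 p.2 with hF
  have hd := hz.differentiableOn (by simp)
  have hD : DifferentiableOn ℝ (fderiv ℝ F) (Set.univ ×ˢ J) :=
    (hz.fderiv_of_isOpen (isOpen_strip hJ) (m := ∞) (by simp)).differentiableOn (by simp)
  have hsymm : IsSymmSndFDerivAt ℝ F (φ, s) :=
    (hz.contDiffAt ((isOpen_strip hJ).mem_nhds (x := (φ, s)) ⟨trivial, hs⟩)).isSymmSndFDerivAt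
      (by rw [minSmoothness_of_isRCLikeNormedField]; exact WithTop.coe_le_coe.2 le_top)
  have h1 := (hasDerivAt_slice_snd hJ (z := fun ψ r => fderiv ℝ F (ψ, r)) hD φ hs).clm_apply
    (hasDerivAt_const s ((1 : ℝ), (0 : ℝ)))
  have h2 := (hasDerivAt_slice_fst hJ (z := fun ψ r => fderiv ℝ F (ψ, r)) hD φ hs).clm_apply
    (hasDerivAt_const φ ((0 : ℝ), (1 : ℝ)))
  have e1 : (fun r => deriv (fun ψ => z ψ r) φ) =ᶠ[nhds s] fun r => fderiv ℝ F (φ, r) (1, 0) := by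
    filter_upwards [hJ.mem_nhds hs] with r hr using (hasDerivAt_slice_fst hJ hd φ hr).deriv
  have e2 : (fun ψ => deriv (fun r => z ψ r) s) = fun ψ => fderiv ℝ F (ψ, s) (0, 1) :=
    funext fun ψ => (hasDerivAt_slice_snd hJ hd ψ hs).deriv
  rw [e1.deriv_eq, e2, h1.deriv, h2.deriv]
  simpa using hsymm (0, 1) (1, 0)

/-- Differentiation under the integral sign over a compact interval. -/
theorem hasDerivAt_intervalIntegral_param {J : Set ℝ} (hJ : IsOpen J) {G : ℝ → ℝ → E}
    (hG : ContDiffOn ℝ ∞ (fun p : ℝ × ℝ => G p.1 p.2) (Set.univ ×ˢ J)) (a b : ℝ) {s : ℝ}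
    (hs : s ∈ J) :
    HasDerivAt (fun r => ∫ φ in a..b, G φ r) (∫ φ in a..b, deriv (fun r => G φ r) s) s := by
  obtain ⟨K, hKs, hKJ, hK⟩ := local_compact_nhds (hJ.mem_nhds hs)
  have hG' := (contDiffOn_deriv_snd hJ hG).continuousOn
  obtain ⟨C, hC⟩ := ((isCompact_uIcc (a := a) (b := b)).prod hK).exists_bound_of_continuousOn
    (hG'.mono (Set.prod_mono (Set.subset_univ _) hKJ))
  have hslice : ∀ r ∈ J, Continuous fun φ => G φ r := fun r hr =>
    (contDiff_slice_fst hG hr).continuous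
  refine (intervalIntegral.hasDerivAt_integral_of_dominated_loc_of_deriv_le
    (F := fun r φ => G φ r) (F' := fun r φ => deriv (fun r => G φ r) r) (bound := fun _ => C)
    hKs ?_ ((hslice s hs).intervalIntegrable a b) ?_ ?_ intervalIntegrable_const ?_).2
  · filter_upwards [hJ.mem_nhds hs] with r hr using (hslice r hr).aestronglyMeasurable
  · exact (contDiff_slice_fst (z := fun φ r => deriv (fun r => G φ r) r)
      (contDiffOn_deriv_snd hJ hG) hs).continuous.aestronglyMeasurable
  · exact .of_forall fun φ hφ r hr => hC (φ, r) ⟨Set.uIoc_subset_uIcc hφ, hr⟩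
  · refine .of_forall fun φ _ r hr => ?_
    exact (hasDerivAt_slice_snd hJ (hG.differentiableOn (by simp)) φ
      (hKJ hr)).differentiableAt.hasDerivAt

end Calculus

/-! ### First variation of the area. -/

theorem deriv_periodic {γ : ℝ → ℂ} {c : ℝ} (h : ∀ φ, γ (φ + c) = γ φ) (φ : ℝ) :
    deriv γ (φ + c) = deriv γ φ := by
  rw [← deriv_comp_add_const]
  simp only [h]

/-- First variation of the symplectic area along a smooth family of closed curves. -/
theorem hasDerivAt_symplecticArea {J : Set ℝ} (hJ : IsOpen J) {z : ℝ → ℝ → ℂ}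
    (hz : ContDiffOn ℝ ∞ (fun p : ℝ × ℝ => z p.1 p.2) (Set.univ ×ˢ J))
    (hp : ∀ s ∈ J, ∀ φ, z (φ + 2 * Real.pi) s = z φ s) {s : ℝ} (hs : s ∈ J) :
    HasDerivAt (fun r => symplecticArea (fun φ => z φ r))
      (-∫ φ in (0 : ℝ)..(2 * Real.pi),
        inner ℝ (Complex.I * deriv (fun ψ => z ψ s) φ) (deriv (fun r => z φ r) s)) s := by
  have hzφ := contDiffOn_deriv_fst hJ.uniqueDiffOn hz
  have hzt := contDiffOn_deriv_snd hJ hz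
  have hG : ContDiffOn ℝ ∞ (fun p : ℝ × ℝ =>
      liouvilleForm (z p.1 p.2) (deriv (fun ψ => z ψ p.2) p.1)) (Set.univ ×ˢ J) :=
    contDiffOn_const.mul ((contDiffOn_const.mul hz).inner ℝ hzφ)
  have hmain := hasDerivAt_intervalIntegral_param hJ
    (G := fun φ r => liouvilleForm (z φ r) (deriv (fun ψ => z ψ r) φ)) hG 0 (2 * Real.pi) hs
  have hslice := contDiff_slice_fst hz hs
  have hsliceφ := contDiff_slice_fst (z := fun φ r => deriv (fun ψ => z ψ r) φ) hzφ hs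
  have hslicet := contDiff_slice_fst (z := fun φ r => deriv (fun r => z φ r) r) hzt hs
  have hb : ∀ φ, HasDerivAt (fun ψ => inner ℝ (Complex.I * z ψ s) (deriv (fun r => z ψ r) s))
      (inner ℝ (Complex.I * z φ s) (deriv (fun ψ => deriv (fun r => z ψ r) s) φ) +
        inner ℝ (Complex.I * deriv (fun ψ => z ψ s) φ) (deriv (fun r => z φ r) s)) φ := fun φ =>
    (((hslice.differentiable (by simp)) φ).hasDerivAt.const_mul Complex.I).inner ℝ
      ((hslicet.differentiable (by simp)) φ).hasDerivAt
  have hcont1 : Continuous fun φ => inner ℝ (Complex.I * deriv (fun ψ => z ψ s) φ)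
      (deriv (fun r => z φ r) s) :=
    (continuous_const.mul hsliceφ.continuous).inner hslicet.continuous
  have hcont2 : Continuous fun φ => inner ℝ (Complex.I * z φ s)
      (deriv (fun ψ => deriv (fun r => z ψ r) s) φ) :=
    (continuous_const.mul hslice.continuous).inner (hslicet.continuous_deriv (by simp))
  -- Integration by parts: the integrand is the `φ`-derivative of the periodic function `⟨iz, ∂ₜz⟩`.
  have hper : ∫ φ in (0 : ℝ)..(2 * Real.pi),
      (inner ℝ (Complex.I * z φ s) (deriv (fun ψ => deriv (fun r => z ψ r) s) φ) +
        inner ℝ (Complex.I * deriv (fun ψ => z ψ s) φ) (deriv (fun r => z φ r) s)) = 0 := by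
    rw [intervalIntegral.integral_eq_sub_of_hasDerivAt (fun φ _ => hb φ)
      ((hcont2.add hcont1).intervalIntegrable _ _)]
    have h1 : z (2 * Real.pi) s = z 0 s := by simpa using hp s hs 0
    have h2 : deriv (fun r => z (2 * Real.pi) r) s = deriv (fun r => z 0 r) s := by
      refine Filter.EventuallyEq.deriv_eq ?_
      filter_upwards [hJ.mem_nhds hs] with r hr
      simpa using hp r hr 0
    rw [h1, h2, sub_self]
  rw [intervalIntegral.integral_add (hcont2.intervalIntegrable _ _)
    (hcont1.intervalIntegrable _ _)] at hper
  refine hmain.congr_deriv ?_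
  have hderiv : ∀ φ, deriv (fun r => liouvilleForm (z φ r) (deriv (fun ψ => z ψ r) φ)) s =
      (1 / 2) * (inner ℝ (Complex.I * z φ s) (deriv (fun ψ => deriv (fun r => z ψ r) s) φ) -
        inner ℝ (Complex.I * deriv (fun ψ => z ψ s) φ) (deriv (fun r => z φ r) s)) := fun φ => by
    have h1 := (hasDerivAt_slice_snd hJ (hz.differentiableOn (by simp)) φ
      hs).differentiableAt.hasDerivAt
    have h2 := (hasDerivAt_slice_snd hJ (z := fun φ r => deriv (fun ψ => z ψ r) φ)
      (hzφ.differentiableOn (by simp)) φ hs).differentiableAt.hasDerivAt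
    rw [deriv_deriv_comm hJ hz φ hs] at h2
    have h3 := ((h1.const_mul Complex.I).inner ℝ h2).const_mul (1 / 2 : ℝ)
    -- The sign comes from the antisymmetry `⟨iv, w⟩ = -⟨iw, v⟩`.
    refine h3.deriv.trans ?_
    simp only [Complex.inner, Complex.mul_re, Complex.mul_im, Complex.conj_re, Complex.conj_im,
      Complex.I_re, Complex.I_im]
    ring
  rw [intervalIntegral.integral_congr fun φ _ => hderiv φ, intervalIntegral.integral_const_mul, intervalIntegral.integral_sub
    (hcont2.intervalIntegrable _ _) (hcont1.intervalIntegrable _ _)]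
  linarith

/-! ### Winding numbers and the integral of the speed. -/

/-- The winding number as the imaginary part of a logarithmic integral. -/
theorem integral_im_logDeriv {γ : ℝ → ℂ} (hγ : ContDiff ℝ 1 γ) (h0 : ∀ φ, γ φ ≠ 0)
    (hp : γ (2 * Real.pi) = γ 0) :
    ∫ φ in (0 : ℝ)..(2 * Real.pi), (deriv γ φ / γ φ).im = 2 * Real.pi * windingNumber γ := by
  have hc : Continuous fun φ => deriv γ φ / γ φ :=
    (hγ.continuous_deriv le_rfl).div hγ.continuous h0
  -- A smooth logarithm of `γ`: since `γ exp(-L)` has zero derivative and equals `1` at `0`, `exp L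
  -- = γ` and `Im L` is a polar angle.
  set L : ℝ → ℂ := fun φ => Complex.log (γ 0) + ∫ ψ in (0 : ℝ)..φ, deriv γ ψ / γ ψ with hL
  have hLd : ∀ φ, HasDerivAt L (deriv γ φ / γ φ) φ := fun φ =>
    (intervalIntegral.integral_hasDerivAt_right (hc.intervalIntegrable _ _)
      hc.aestronglyMeasurable.stronglyMeasurableAtFilter hc.continuousAt).const_add _
  have hL0 : L 0 = Complex.log (γ 0) := by simp [hL]
  have hd : ∀ φ, HasDerivAt (fun ψ => γ ψ * Complex.exp (-L ψ)) 0 φ := fun φ => by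
    refine (((hγ.differentiable (by simp)) φ).hasDerivAt.mul (hLd φ).neg.cexp).congr_deriv ?_
    rw [mul_comm (Complex.exp _), ← mul_assoc, mul_neg, mul_div_cancel₀ _ (h0 φ)]
    ring
  have hexp : ∀ φ, Complex.exp (L φ) = γ φ := fun φ => by
    have h1 := is_const_of_deriv_eq_zero (fun ψ => (hd ψ).differentiableAt)
      (fun ψ => (hd ψ).deriv) φ 0
    simp only [hL0, Complex.exp_neg, Complex.exp_log (h0 0), mul_inv_cancel₀ (h0 0)] at h1
    rw [← div_eq_mul_inv, div_eq_one_iff_eq (Complex.exp_ne_zero _)] at h1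
    exact h1.symm
  have hθ : IsAngle γ fun φ => (L φ).im := by
    refine ⟨Complex.continuous_im.comp
      (continuous_iff_continuousAt.2 fun φ => (hLd φ).continuousAt), fun φ => ?_⟩
    rw [← hexp φ, Complex.norm_exp, Complex.ofReal_exp, ← Complex.exp_add, Complex.re_add_im]
  rw [← windingNumber_spec hγ.continuous h0 hp hθ]
  refine intervalIntegral.integral_eq_sub_of_hasDerivAt (f := fun φ => (L φ).im) (fun φ _ => ?_)
    ((Complex.continuous_im.comp hc).intervalIntegrable _ _)
  exact Complex.imCLM.hasFDerivAt.comp_hasDerivAt φ (hLd φ)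

theorem unitNormal_eq_smul (γ : ℝ → ℂ) (φ : ℝ) :
    unitNormal γ φ = (‖deriv γ φ‖⁻¹) • (-(Complex.I * deriv γ φ)) := by
  rw [unitNormal, Complex.real_smul]
  push_cast
  ring

theorem inner_I_mul_deriv_unitNormal (γ : ℝ → ℂ) (φ : ℝ) :
    inner ℝ (Complex.I * deriv γ φ) (unitNormal γ φ) = -‖deriv γ φ‖ := by
  rw [unitNormal_eq_smul, inner_smul_right, inner_neg_right, real_inner_self_eq_norm_sq, norm_mul, Complex.norm_I,
    one_mul]
  -- Where `γ'` vanishes, both sides are `0`.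
  rcases eq_or_ne ‖deriv γ φ‖ 0 with h0 | h0
  · simp [h0]
  · field_simp

/-- The speed integrand `f |γ'|` is a combination of angular velocities. -/
theorem speed_mul_norm_deriv (n : ℕ) {γ : ℝ → ℂ} {φ : ℝ} (h1 : deriv γ φ ≠ 0) :
    speed n γ φ * ‖deriv γ φ‖ = (deriv (deriv γ) φ / deriv γ φ).im +
      ((n : ℝ) - 1) * (deriv γ φ / γ φ).im := by
  have hnorm : ‖deriv γ φ‖ ≠ 0 := norm_ne_zero_iff.2 h1
  have hk : ∀ w v : ℂ, (w / v).im = -inner ℝ w (-(Complex.I * v)) / ‖v‖ ^ 2 := fun w v => by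
    rw [Complex.div_im, Complex.normSq_eq_norm_sq]
    simp only [Complex.inner, Complex.neg_re, Complex.neg_im, Complex.mul_re, Complex.mul_im,
      Complex.conj_re, Complex.conj_im, Complex.I_re, Complex.I_im]
    ring
  have hk' : ∀ w v : ℂ, (v / w).im = inner ℝ w (-(Complex.I * v)) / ‖w‖ ^ 2 := fun w v => by
    rw [Complex.div_im, Complex.normSq_eq_norm_sq]
    simp only [Complex.inner, Complex.neg_re, Complex.neg_im, Complex.mul_re, Complex.mul_im,
      Complex.conj_re, Complex.conj_im, Complex.I_re, Complex.I_im]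
    ring
  rw [hk, hk', speed, curvature, unitNormal_eq_smul, inner_smul_right, inner_smul_right]
  field_simp

/-- `∫ f ds = 2π (rot γ + (n - 1) wind γ)`. -/
theorem integral_speed (n : ℕ) {γ : ℝ → ℂ} (hγ : ContDiff ℝ ∞ γ) (h0 : ∀ φ, γ φ ≠ 0)
    (h1 : ∀ φ, deriv γ φ ≠ 0) (hp : ∀ φ, γ (φ + 2 * Real.pi) = γ φ) :
    ∫ φ in (0 : ℝ)..(2 * Real.pi), speed n γ φ * ‖deriv γ φ‖ =
      2 * Real.pi * ((rotationNumber γ : ℝ) + ((n : ℝ) - 1) * (windingNumber γ : ℝ)) := by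
  have hγ' : ContDiff ℝ ∞ (deriv γ) := (contDiff_infty_iff_deriv.1 hγ).2
  have hc1 : Continuous fun φ => (deriv (deriv γ) φ / deriv γ φ).im :=
    Complex.continuous_im.comp ((hγ'.continuous_deriv (by simp)).div hγ'.continuous h1)
  have hc2 : Continuous fun φ => (deriv γ φ / γ φ).im :=
    Complex.continuous_im.comp (hγ'.continuous.div hγ.continuous h0)
  have e1 := integral_im_logDeriv (hγ'.of_le (by simp)) h1
    (by simpa using deriv_periodic hp 0)
  have e2 := integral_im_logDeriv (hγ.of_le (by simp)) h0 (by simpa using hp 0)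
  rw [intervalIntegral.integral_congr fun φ _ => speed_mul_norm_deriv n (h1 φ),
    intervalIntegral.integral_add (hc1.intervalIntegrable _ _)
      ((hc2.intervalIntegrable _ _).const_mul _), intervalIntegral.integral_const_mul, e1, e2,
    rotationNumber]
  ring

/-! ### Invariance in time and evolution of the area. -/

/-- Homotopy invariance of the winding number along a family of smooth curves. -/
theorem windingNumber_eq_of_family {J : Set ℝ} (hJ : UniqueDiffOn ℝ J) (hc : IsPreconnected J)
    {z : ℝ → ℝ → ℂ} (hz : ContDiffOn ℝ ∞ (fun p : ℝ × ℝ => z p.1 p.2) (Set.univ ×ˢ J))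
    (h0 : ∀ s ∈ J, ∀ φ, z φ s ≠ 0) (hp : ∀ s ∈ J, z (2 * Real.pi) s = z 0 s) {s r : ℝ}
    (hs : s ∈ J) (hr : r ∈ J) :
    windingNumber (fun φ => z φ s) = windingNumber (fun φ => z φ r) := by
  have hcont : ContinuousOn (fun s => ∫ φ in (0 : ℝ)..(2 * Real.pi),
      (deriv (fun ψ => z ψ s) φ / z φ s).im) J :=
    continuousOn_intervalIntegral_param (G := fun φ s => (deriv (fun ψ => z ψ s) φ / z φ s).im)
      (Complex.continuous_im.comp_continuousOn
        ((contDiffOn_deriv_fst hJ hz).continuousOn.div hz.continuousOn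
          fun p hp => h0 p.2 hp.2 p.1)) _ _
  have hw : ContinuousOn (fun s => windingNumber (fun φ => z φ s)) J := by
    -- Continuity into the discrete space `ℤ` may be tested in `ℝ`, where the integral formula
    -- applies.
    rw [Int.isClosedEmbedding_coe_real.isInducing.continuousOn_iff]
    refine (hcont.const_smul (2 * Real.pi)⁻¹).congr fun s hs => ?_
    have := integral_im_logDeriv ((contDiff_slice_fst hz hs).of_le (by simp)) (h0 s hs) (hp s hs)
    change _ = (2 * Real.pi)⁻¹ * ∫ φ in (0 : ℝ)..(2 * Real.pi), _
    rw [this, inv_mul_cancel_left₀ Real.two_pi_pos.ne', Function.comp_apply]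
  exact hc.constant hw hs hr

theorem continuousOn_symplecticArea {J : Set ℝ} (hJ : UniqueDiffOn ℝ J) {z : ℝ → ℝ → ℂ}
    (hz : ContDiffOn ℝ ∞ (fun p : ℝ × ℝ => z p.1 p.2) (Set.univ ×ˢ J)) :
    ContinuousOn (fun s => symplecticArea (fun φ => z φ s)) J :=
  continuousOn_intervalIntegral_param
    (G := fun φ s => liouvilleForm (z φ s) (deriv (fun ψ => z ψ s) φ))
    (continuousOn_const.mul ((continuousOn_const.mul hz.continuousOn).inner
      (contDiffOn_deriv_fst hJ hz).continuousOn)) _ _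

/-- Openness of `J` turns the flow's derivative within `[0, T)` into a two-sided one; time `0` is
thereby excluded. -/
theorem IsSmoothSolution.hasDerivAt_symplecticArea {n : ℕ} {T : EReal} {z : ℝ → ℝ → ℂ}
    (hz : IsSmoothSolution n T z) {J : Set ℝ} (hJ : IsOpen J) (hJT : J ⊆ timeInterval T) {s : ℝ}
    (hs : s ∈ J) :
    HasDerivAt (fun r => symplecticArea (fun φ => z φ r))
      (-(2 * Real.pi * ((rotationNumber (fun φ => z φ s) : ℝ) +
        ((n : ℝ) - 1) * (windingNumber (fun φ => z φ s) : ℝ)))) s := by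
  have hsT := hJT hs
  have hsm := hz.smooth.mono (Set.prod_mono subset_rfl hJT)
  have h := EquivariantFlow.hasDerivAt_symplecticArea hJ hsm (fun r hr => hz.periodic r (hJT hr)) hs
  rw [← integral_speed n (contDiff_slice_fst hsm hs) (hz.ne_zero s hsT) (hz.regular s hsT)
    (hz.periodic s hsT)]
  convert h using 2
  refine intervalIntegral.integral_congr fun φ _ => ?_
  have hf := ((hz.flow s hsT φ).hasDerivAt (Filter.mem_of_superset (hJ.mem_nhds hs) hJT)).deriv
  rw [hf, inner_neg_right, ← Complex.real_smul, inner_smul_right, inner_I_mul_deriv_unitNormal]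
  ring

end EquivariantFlow

theorem theorem3 (n : ℕ) (hn : 1 ≤ n) (T : EReal) (z : ℝ → ℝ → ℂ)
    (hz : EquivariantFlow.IsSmoothSolution n T z)
    (t : ℝ) (ht : t ∈ EquivariantFlow.timeInterval T) :
    EquivariantFlow.symplecticArea (fun φ => z φ t) =
      EquivariantFlow.symplecticArea (fun φ => z φ 0) -
        2 * Real.pi *
          ((EquivariantFlow.rotationNumber (fun φ => z φ 0) : ℝ) +
            ((n : ℝ) - 1) * (EquivariantFlow.windingNumber (fun φ => z φ 0) : ℝ)) * t := by
  -- For `t = 0` the interval `[0, t]` is a point, without unique derivatives.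
  rcases ht.1.eq_or_lt with rfl | htpos
  · simp
  have hsub : Set.Icc 0 t ⊆ EquivariantFlow.timeInterval T := fun s hs =>
    ⟨hs.1, (EReal.coe_le_coe_iff.2 hs.2).trans_lt ht.2⟩
  have hU : UniqueDiffOn ℝ (Set.Icc 0 t) := uniqueDiffOn_Icc htpos
  have hsm := hz.smooth.mono (Set.prod_mono subset_rfl hsub)
  have h0 : (0 : ℝ) ∈ Set.Icc 0 t := ⟨le_rfl, htpos.le⟩
  -- The mean value theorem needs only continuity at the endpoints. The slope at the unknown time
  -- `s` is then computed from the invariants at time `0`.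
  obtain ⟨s, hs, hslope⟩ := exists_hasDerivAt_eq_slope _ _ htpos
    (EquivariantFlow.continuousOn_symplecticArea hU hsm)
    (fun s hs => hz.hasDerivAt_symplecticArea isOpen_Ioo (Set.Ioo_subset_Icc_self.trans hsub) hs)
  have hs' := Set.Ioo_subset_Icc_self hs
  have hwind := EquivariantFlow.windingNumber_eq_of_family hU isPreconnected_Icc hsm
    (fun r hr => hz.ne_zero r (hsub hr)) (fun r hr => by simpa using hz.periodic r (hsub hr) 0)
    hs' h0
  have hrot : EquivariantFlow.rotationNumber (fun φ => z φ s) =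
      EquivariantFlow.rotationNumber (fun φ => z φ 0) :=
    -- Regularity makes the tangent curves a family avoiding the origin.
    EquivariantFlow.windingNumber_eq_of_family (z := fun φ r => deriv (fun ψ => z ψ r) φ) hU
      isPreconnected_Icc (EquivariantFlow.contDiffOn_deriv_fst hU hsm)
      (fun r hr => hz.regular r (hsub hr))
      (fun r hr => by
        simpa using EquivariantFlow.deriv_periodic (hz.periodic r (hsub hr)) 0) hs' h0
  rw [hwind, hrot, sub_zero, eq_div_iff htpos.ne'] at hslope
  linarith
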